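/- Let $q=p^{e}$ with $p$ an odd prime and $e\ge 1$, and let $\mathbb{F}_q$ be the finite field with $q$ elements. A linear $[N,k]_q$ code is a $k$-dimensional subspace $\mathcal{C}$ of $\mathbb{F}_q^{N}$; it is MDS if its minimum Hamming distance is $N-k+1$. The $l$-Galois hull of $\mathcal{C}$ is $\mathcal{C}\cap\mathcal{C}^{\perp_l}$, where $\mathcal{C}^{\perp_l}=\{\mathbf{x}\in\mathbb{F}_q^{N} : \sum_{i=1}^{N} y_i x_i^{p^l}=0 \text{ for all } \mathbf{y}\in\mathcal{C}\}$. For distinct $a_1,\dots,a_N\in\mathbb{F}_q$ and nonzero $v_1,\dots,v_N\in\mathbb{F}_q$, the generalized Reed-Solomon (GRS) code of dimension $k$ with evaluation points $a_i$ is $\{(v_1f(a_1),\dots,v_Nf(a_N)) : f\in\mathbb{F}_q[x],\ \deg f\le k-1\}$, and the extended GRS code with finite evaluation points $a_i$ is $\{(v_1f(a_1),\dots,v_Nf(a_N),f_{k-1}) : f\in\mathbb{F}_q[x],\ \deg f\le k-1\}$, where $f_{k-1}$ is the coefficient of $x^{k-1}$ in $f$. Assume $2l\mid e$ and $m\mid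 (q-1)$. Set $y=\frac{q-1}{p^{l}-1}$ and $m_1=\frac{m}{\gcd(m,y)}$, and let $n=rm$ with $1\le r\le \frac{p^{l}-1}{m_1}$. Then there is a set $S\subseteq\mathbb{F}_q^{*}$ that is the union of $r$ distinct cosets of the subgroup of order $m$ of $\mathbb{F}_q^{*}$, such that for every $k$ with $1\le k\le\left\lfloor\frac{p^{l}+n}{p^{l}+1}\right\rfloor$: (1) for every $0\le h\le k-1$ there is an $[n,k]_q$ MDS code with $h$-dimensional $l$-Galois hull, which is a GRS code with set of evaluation points $S$; (2) for every $0\le h\le k$ there is an $[n+1,k]_q$ MDS code with $h$-dimensional $l$-Galois hull, which is a GRS code with set of evaluation points $S\cup\{0\}$; (3) for every $0\le h\le k-1$ there is an $[n+2,k]_q$ MDS code with $h$-dimensional $l$-Galois hull, which is an extended GRS code with set of finite evaluation points $S\cup\{0\}$. -/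

import Mathlib

open Polynomial

/-- The `l`-Galois form `(x, y)_l = ∑ i, x i * y i ^ (p ^ l)` on `F ^ ι`. -/
def galoisForm {F ι : Type*} [Field F] [Fintype ι] (p l : ℕ) (x y : ι → F) : F :=
  ∑ i, x i * y i ^ p ^ l

/-- The `l`-Galois dual code: all `x` with `(y, x)_l = 0` for every codeword `y` of `C`. -/
def galoisDual {F ι : Type*} [Field F] [Fintype ι] (p l : ℕ) [Fact p.Prime] [CharP F p]
    (C : Submodule F (ι → F)) : Submodule F (ι → F) where
  carrier := {x | ∀ y ∈ C, galoisForm p l y x = 0}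
  zero_mem' := by
    intro y _
    have h : p ^ l ≠ 0 := pow_ne_zero _ (Fact.out : p.Prime).ne_zero
    simp [galoisForm, zero_pow h, -mul_eq_zero]
  add_mem' := by
    intro a b ha hb y hy
    have h1 := ha y hy
    have h2 := hb y hy
    simp only [galoisForm] at h1 h2 ⊢
    simp only [Pi.add_apply, add_pow_char_pow, mul_add, Finset.sum_add_distrib, h1, h2, add_zero]
  smul_mem' := by
    intro c a ha y hy
    have h1 := ha y hy
    simp only [galoisForm] at h1 ⊢
    simp only [Pi.smul_apply, smul_eq_mul, mul_pow, mul_left_comm _ (c ^ p ^ l),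
      ← Finset.mul_sum, h1, mul_zero]

/-- The `l`-Galois hull of a linear code. -/
def galoisHull {F ι : Type*} [Field F] [Fintype ι] (p l : ℕ) [Fact p.Prime] [CharP F p]
    (C : Submodule F (ι → F)) : Submodule F (ι → F) :=
  C ⊓ galoisDual p l C

open Classical in
/-- The minimum Hamming distance between two distinct codewords. -/
noncomputable def minDist {F ι : Type*} [Field F] [Fintype ι] (C : Submodule F (ι → F)) : ℕ :=
  sInf {d | ∃ x ∈ C, ∃ y ∈ C, x ≠ y ∧ hammingDist x y = d}

/-- `C` is an `[N, k]` MDS code over `F`: a `k`-dimensional subspace of `F ^ N` whose minimum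
distance `d` attains the Singleton bound `d = N + 1 - k`. -/
def IsMDSCode {F : Type*} [Field F] {N : ℕ} (k : ℕ) (C : Submodule F (Fin N → F)) : Prop :=
  Module.finrank F C = k ∧ minDist C + k = N + 1

/-- The generalized Reed-Solomon code `GRS_k(a, v)`. -/
noncomputable def grsCode {F : Type*} [Field F] {N : ℕ} (k : ℕ) (a v : Fin N → F) :
    Submodule F (Fin N → F) :=
  (degreeLT F k).map
    (LinearMap.pi fun i => v i • leval (a i))

/-- The extended generalized Reed-Solomon code `GRS_k(a, v, ∞)` (for `k ≥ 1`), whose last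
coordinate is the coefficient of `X ^ (k - 1)`. -/
noncomputable def extGrsCode {F : Type*} [Field F] {N : ℕ} (k : ℕ) (a v : Fin N → F) :
    Submodule F (Fin (N + 1) → F) :=
  (degreeLT F k).map
    (LinearMap.pi (Fin.snoc (α := fun _ => F[X] →ₗ[F] F)
      (fun i => v i • leval (a i)) (lcoeff F (k - 1))))

/-- `C` is a generalized Reed-Solomon code with set of evaluation points `S` and nonzero
column multipliers. -/
def IsGRSOn {F : Type*} [Field F] {N : ℕ} (k : ℕ) (S : Set F)
    (C : Submodule F (Fin N → F)) : Prop :=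
  ∃ a v : Fin N → F, Function.Injective a ∧ Set.range a = S ∧ (∀ i, v i ≠ 0) ∧
    C = grsCode k a v

/-- `C` is an extended generalized Reed-Solomon code with set of finite evaluation points `S`
and nonzero column multipliers. -/
def IsExtGRSOn {F : Type*} [Field F] {N : ℕ} (k : ℕ) (S : Set F)
    (C : Submodule F (Fin (N + 1) → F)) : Prop :=
  ∃ a v : Fin N → F, Function.Injective a ∧ Set.range a = S ∧ (∀ i, v i ≠ 0) ∧
    C = extGrsCode k a v

/-- `S` is the union of `r` distinct cosets of a subgroup of order `m` of the multiplicative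
group of `F`. -/
def IsUnionOfCosets {F : Type*} [Field F] (m r : ℕ) (S : Set F) : Prop :=
  ∃ (H : Subgroup Fˣ) (η : Fin r → Fˣ), Nat.card H = m ∧
    (∀ i j, i ≠ j → (η i)⁻¹ * η j ∉ H) ∧
    S = {x | ∃ i, ∃ t ∈ H, x = ((η i * t : Fˣ) : F)}

/-!
Put `Q = p ^ l`. Since `(Q - 1) * (Q + 1)` divides `q - 1`, the field `F` contains the subfield of
`Q` elements, the solutions of `x ^ Q = x`, and each of its nonzero elements is a `(Q + 1)`-th power
in `F` (`exists_pow_add_one_eq_of_pow_eq_self`).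

The set `S` is `{x | x ^ m ∈ B}`, where `B` consists of `r` of the nonzero `m`-th powers in that
subfield; there are `(Q - 1) / m₁` of them (`exists_cosetReps`). The polynomial with simple roots
`S ∪ {0}` is `N = X * G(X ^ m)` with `G = ∏ (X - b)` over the subfield, so `N'` takes values in the
subfield at the points of `S ∪ {0}`, and so do the Lagrange weights `w x = 1 / N'(x)`. Hence
multipliers with `v x ^ (Q + 1) = w x` exist. With them the Galois form of the codewords of `g` and
`f` is `∑ w x * g(x) * f(x) ^ Q`; the bound on `k` makes `g * f ^ Q` a polynomial of degree less
than `n`, for which the sum over `S ∪ {0}` vanishes (`exists_evaluationSet`). On `S ∪ {0}` the form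
is therefore zero; on `S` alone it is `-w 0 * g(0) * f(0) ^ Q`; and with the point at infinity added
to `S ∪ {0}` it is `g_{k-1} * f_{k-1} ^ Q` in the coefficients of `X ^ (k - 1)`.

To shrink the hull, the weights are doubled on a subset `T` of `S` (`exists_multipliers`), which
adds `∑ x ∈ T, w x * g(x) * f(x) ^ Q`. The form is then diagonal in the values at a set `J` of at
most `k` points of the projective line. By interpolation these values are independent on polynomials
of degree `< k`, so the hull consists of the codewords of polynomials vanishing on `J` and has
dimension `k - |J|` (`finrank_galoisHull_projCode`).
-/

/-! ### Codes on the projective line -/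

/-- The evaluation functionals of the projective line, on polynomials of degree `< k`: evaluation
at a finite point, and the coefficient of `X ^ (k - 1)` at the point at infinity `none`. -/
noncomputable def projEval {F : Type*} [Field F] (k : ℕ) : Option F → F[X] →ₗ[F] F
  | none => lcoeff F (k - 1)
  | some a => leval a

/-- The code of all `(v i * f (pt i))_i` for `f` of degree `< k`, where `pt i` is a point of the
projective line over `F`. Both `grsCode` and `extGrsCode` have this form. -/
noncomputable def projCode {F : Type*} [Field F] {N : ℕ} (k : ℕ) (pt : Fin N → Option F)
    (v : Fin N → F) : Submodule F (Fin N → F) :=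
  (degreeLT F k).map (LinearMap.pi fun i => v i • projEval k (pt i))

section ProjectiveLine

variable {F : Type*} [Field F]

@[simp] lemma projEval_some (k : ℕ) (a : F) (f : F[X]) : projEval k (some a) f = f.eval a := rfl

@[simp] lemma projEval_none (k : ℕ) (f : F[X]) : projEval k none f = f.coeff (k - 1) := rfl

lemma grsCode_eq_projCode {N : ℕ} (k : ℕ) (a v : Fin N → F) :
    grsCode k a v = projCode k (fun i => some (a i)) v := rfl

lemma extGrsCode_eq_projCode {N : ℕ} (k : ℕ) (a v : Fin N → F) :
    extGrsCode k a v =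
      projCode k (Fin.snoc (α := fun _ => Option F) (fun i => some (a i)) none)
        (Fin.snoc (α := fun _ => F) v 1) := by
  unfold extGrsCode projCode
  congr 2
  funext i
  refine Fin.lastCases ?_ (fun j => ?_) i
  · simp [projEval]
  · simp [projEval]

/-- A nonzero polynomial of degree `< k` vanishes at fewer than `k` points of the projective
line: vanishing at infinity lowers the degree by one. -/
lemma card_lt_of_projEval_eq_zero {k : ℕ} {f : F[X]} (hf : f ∈ degreeLT F k) (hf0 : f ≠ 0)
    (s : Finset (Option F)) (hs : ∀ x ∈ s, projEval k x f = 0) : s.card < k := by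
  classical
  rw [mem_degreeLT] at hf
  by_contra! hk
  have hnat : f.natDegree < k := (natDegree_lt_iff_degree_lt hf0).2 hf
  have hroot : s.eraseNone.card ≤ f.natDegree := by
    by_contra! hlt
    refine hf0 (eq_zero_of_degree_lt_of_eval_finset_eq_zero s.eraseNone ?_ fun x hx => ?_)
    · exact (natDegree_lt_iff_degree_lt hf0).1 hlt
    · exact hs (some x) (Finset.mem_eraseNone.1 hx)
  by_cases hn : none ∈ s
  · have hc : f.coeff (k - 1) = 0 := hs none hn
    have hne : f.natDegree ≠ k - 1 := by
      intro h
      rw [← h] at hc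
      exact hf0 (leadingCoeff_eq_zero.1 hc)
    have := Finset.card_eraseNone_of_mem hn
    omega
  · have := Finset.card_eraseNone_of_not_mem hn
    omega

lemma finrank_degreeLT (k : ℕ) : Module.finrank F (degreeLT F k) = k := by
  rw [(degreeLTEquiv F k).finrank_eq]; simp

instance finiteDimensional_degreeLT (k : ℕ) : FiniteDimensional F (degreeLT F k) :=
  (degreeLTEquiv F k).symm.finiteDimensional

/-- Interpolation: the values at `≤ k` points of the projective line of a polynomial of degree
`< k` can be prescribed, provided the line has at least `k` points in all. -/
lemma surjective_projEval [Finite F] {k : ℕ} (J : Finset (Option F)) (hJ : J.card ≤ k)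
    (hk : k ≤ Nat.card F) :
    Function.Surjective ((LinearMap.pi fun j : J => projEval k j.1) ∘ₗ (degreeLT F k).subtype) := by
  classical
  have := Fintype.ofFinite F
  obtain ⟨J', hJJ', hJ'⟩ := Finset.exists_superset_card_eq hJ
    (show k ≤ Fintype.card (Option F) by
      rw [Fintype.card_option, ← Nat.card_eq_fintype_card]; omega)
  let L : degreeLT F k →ₗ[F] (J' → F) :=
    (LinearMap.pi fun j : J' => projEval k j.1) ∘ₗ (degreeLT F k).subtype
  have hinj : Function.Injective L := by
    rw [injective_iff_map_eq_zero]
    intro f hf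
    by_contra h0
    have := card_lt_of_projEval_eq_zero f.2 (by simpa using h0) J'
      (fun x hx => congrFun hf ⟨x, hx⟩)
    omega
  have hsurj : Function.Surjective L :=
    (LinearMap.injective_iff_surjective_of_finrank_eq_finrank
      (by rw [finrank_degreeLT]; simp [hJ'])).1 hinj
  intro t
  obtain ⟨f, hf⟩ := hsurj fun j => if h : j.1 ∈ J then t ⟨j.1, h⟩ else 0
  refine ⟨f, funext fun j => ?_⟩
  have := congrFun hf ⟨j.1, hJJ' j.2⟩
  simpa [L] using this

lemma injective_projCode {N k : ℕ} {pt : Fin N → Option F} (hpt : Function.Injective pt)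
    {v : Fin N → F} (hv : ∀ i, v i ≠ 0) (hkN : k ≤ N) :
    Function.Injective ((LinearMap.pi fun i => v i • projEval k (pt i)) ∘ₗ
      (degreeLT F k).subtype) := by
  classical
  rw [injective_iff_map_eq_zero]
  intro f hf
  by_contra h0
  have := card_lt_of_projEval_eq_zero f.2 (by simpa using h0) (Finset.univ.image pt) (by
    intro x hx
    obtain ⟨i, -, rfl⟩ := Finset.mem_image.1 hx
    simpa [hv i] using congrFun hf i)
  rw [Finset.card_image_of_injective _ hpt, Finset.card_fin] at this
  omega

lemma projCode_eq_range {N : ℕ} (k : ℕ) (pt : Fin N → Option F) (v : Fin N → F) :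
    projCode k pt v = LinearMap.range ((LinearMap.pi fun i => v i • projEval k (pt i)) ∘ₗ
      (degreeLT F k).subtype) := by
  rw [LinearMap.range_comp, Submodule.range_subtype]; rfl

lemma mem_projCode {N k : ℕ} {pt : Fin N → Option F} {v c : Fin N → F} :
    c ∈ projCode k pt v ↔
      ∃ f ∈ degreeLT F k, (fun i => v i * projEval k (pt i) f) = c := by
  simp only [projCode, Submodule.mem_map]
  rfl

/-- Codes on distinct points of the projective line are MDS. -/
lemma isMDSCode_projCode {N k : ℕ} {pt : Fin N → Option F} (hpt : Function.Injective pt)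
    {v : Fin N → F} (hv : ∀ i, v i ≠ 0) (hk : 1 ≤ k) (hkN : k ≤ N) :
    IsMDSCode k (projCode k pt v) := by
  classical
  refine ⟨?_, ?_⟩
  · rw [projCode_eq_range, LinearMap.finrank_range_of_inj (injective_projCode hpt hv hkN),
      finrank_degreeLT]
  have hsum : ∀ x y : Fin N → F,
      hammingDist x y + (Finset.univ.filter fun i => x i = y i).card = N := by
    intro x y
    have := Finset.card_filter_add_card_filter_not (s := (Finset.univ : Finset (Fin N)))
      (fun i => x i = y i)
    rw [Finset.card_fin] at this
    rw [hammingDist, add_comm]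
    exact this
  have hlow : ∀ x ∈ projCode k pt v, ∀ y ∈ projCode k pt v, x ≠ y →
      N + 1 - k ≤ hammingDist x y := by
    intro x hx y hy hxy
    obtain ⟨f, hf, hfxy⟩ := mem_projCode.1 (Submodule.sub_mem _ hx hy)
    have hf0 : f ≠ 0 := by
      rintro rfl
      apply hxy
      rw [← sub_eq_zero, ← hfxy]
      funext i
      simp
    have h1 := card_lt_of_projEval_eq_zero hf hf0
      ((Finset.univ.filter fun i => x i = y i).image pt) (by
        intro z hz
        obtain ⟨i, hi, rfl⟩ := Finset.mem_image.1 hz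
        have h2 := congrFun hfxy i
        have h3 : x i = y i := by simpa using hi
        simpa [h3, hv i] using h2)
    rw [Finset.card_image_of_injective _ hpt] at h1
    have := hsum x y
    omega
  -- a nonzero codeword vanishing at `k - 1` chosen positions exists by a dimension count
  have hmem : N + 1 - k ∈ {d | ∃ x ∈ projCode k pt v, ∃ y ∈ projCode k pt v,
      x ≠ y ∧ hammingDist x y = d} := by
    let L : degreeLT F k →ₗ[F] (Fin (k - 1) → F) :=
      (LinearMap.pi fun i : Fin (k - 1) => projEval k (pt (i.castLE (by omega)))) ∘ₗ
        (degreeLT F k).subtype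
    have hker : LinearMap.ker L ≠ ⊥ :=
      LinearMap.ker_ne_bot_of_finrank_lt (by rw [finrank_degreeLT]; simp; omega)
    obtain ⟨f, hf, hf0⟩ := Submodule.exists_mem_ne_zero_of_ne_bot hker
    set c : Fin N → F := fun i => v i * projEval k (pt i) f.1 with hc
    have hcmem : c ∈ projCode k pt v := mem_projCode.2 ⟨f.1, f.2, rfl⟩
    have hc0 : c ≠ 0 := by
      intro h
      exact hf0 ((injective_iff_map_eq_zero _).1 (injective_projCode hpt hv hkN) f h)
    refine ⟨c, hcmem, 0, Submodule.zero_mem _, hc0, le_antisymm ?_ ?_⟩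
    · have h1 : k - 1 ≤ (Finset.univ.filter fun i => c i = (0 : Fin N → F) i).card := by
        have : (Finset.univ.image fun i : Fin (k - 1) => i.castLE (show k - 1 ≤ N by omega)) ⊆
            Finset.univ.filter fun i => c i = (0 : Fin N → F) i := by
          intro z hz
          obtain ⟨i, -, rfl⟩ := Finset.mem_image.1 hz
          have := congrFun (LinearMap.mem_ker.1 hf) i
          simp only [Finset.mem_filter, Finset.mem_univ, true_and, hc, Pi.zero_apply]
          exact mul_eq_zero_of_right _ this
        have h2 := Finset.card_le_card this
        rwa [Finset.card_image_of_injective _ (Fin.castLE_injective _), Finset.card_fin] at h2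
      have := hsum c 0
      omega
    · exact hlow _ hcmem _ (Submodule.zero_mem _) hc0
  have : minDist (projCode k pt v) = N + 1 - k := by
    unfold minDist
    refine le_antisymm (Nat.sInf_le ?_) (le_csInf ⟨N + 1 - k, ?_⟩ ?_)
    · convert hmem
    · convert hmem
    · rintro d ⟨x, hx, y, hy, hxy, rfl⟩
      convert hlow x hx y hy hxy
  omega

/-- If the `l`-Galois form, pulled back to polynomials of degree `< k`, is diagonal in the values
at the points of `J`, then the hull consists of the codewords of polynomials vanishing on `J`. -/
lemma finrank_galoisHull_projCode [Finite F] {p l N k : ℕ} [Fact p.Prime] [CharP F p]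
    {pt : Fin N → Option F} (hpt : Function.Injective pt)
    {v : Fin N → F} (hv : ∀ i, v i ≠ 0) (hkN : k ≤ N) (hkF : k ≤ Nat.card F)
    (J : Finset (Option F)) (hJ : J.card ≤ k) (c : Option F → F) (hc : ∀ j ∈ J, c j ≠ 0)
    (hform : ∀ f ∈ degreeLT F k, ∀ g ∈ degreeLT F k,
      galoisForm p l (fun i => v i * projEval k (pt i) g) (fun i => v i * projEval k (pt i) f) =
        ∑ j ∈ J, c j * (projEval k j g * projEval k j f ^ p ^ l)) :
    Module.finrank F (galoisHull p l (projCode k pt v)) = k - J.card := by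
  classical
  set E := (LinearMap.pi fun i => v i • projEval k (pt i)) ∘ₗ (degreeLT F k).subtype with hE
  set L := (LinearMap.pi fun j : J => projEval k j.1) ∘ₗ (degreeLT F k).subtype with hL
  have hLs : Function.Surjective L := surjective_projEval J hJ hkF
  have hhull : galoisHull p l (projCode k pt v) = (LinearMap.ker L).map E := by
    ext x
    constructor
    · rintro ⟨hx, hx'⟩
      obtain ⟨f, hf, rfl⟩ := mem_projCode.1 hx
      refine ⟨⟨f, hf⟩, LinearMap.mem_ker.2 (funext fun j => ?_), rfl⟩
      -- test against the polynomial that is `1` at `j` and `0` on the rest of `J`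
      obtain ⟨g, hg⟩ := hLs (Pi.single j 1)
      have h1 := hx' _ (mem_projCode.2 ⟨g.1, g.2, rfl⟩)
      rw [hform f hf g.1 g.2, Finset.sum_eq_single j.1] at h1
      · have hgj : projEval k j.1 g.1 = 1 := by simpa [hL] using congrFun hg j
        rw [hgj, one_mul] at h1
        exact eq_zero_of_pow_eq_zero ((mul_eq_zero.1 h1).resolve_left (hc j.1 j.2))
      · intro b hb hbj
        have hgb : projEval k b g.1 = 0 := by
          have := congrFun hg ⟨b, hb⟩
          rwa [Pi.single_eq_of_ne (by simpa [Subtype.ext_iff] using hbj)] at this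
        simp [hgb]
      · exact fun h => absurd j.2 h
    · rintro ⟨f, hf, rfl⟩
      refine ⟨mem_projCode.2 ⟨f.1, f.2, rfl⟩, ?_⟩
      intro y hy
      obtain ⟨g, hg, rfl⟩ := mem_projCode.1 hy
      refine (hform f.1 f.2 g hg).trans (Finset.sum_eq_zero fun j hj => ?_)
      have : projEval k j f.1 = 0 := congrFun (LinearMap.mem_ker.1 hf) ⟨j, hj⟩
      rw [this, zero_pow (pow_ne_zero _ (Fact.out : p.Prime).ne_zero), mul_zero, mul_zero]
  rw [hhull, ← (Submodule.equivMapOfInjective E (injective_projCode hpt hv hkN) _).finrank_eq]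
  have h1 := LinearMap.finrank_range_add_finrank_ker L
  rw [LinearMap.range_eq_top.2 hLs, finrank_top, finrank_degreeLT] at h1
  simp at h1
  omega

end ProjectiveLine

/-! ### Norms, cosets and the evaluation set -/

section NormAndCosets

variable {F : Type*} [Field F] [Finite F]

/-- In a cyclic group whose order is divisible by `(Q - 1) * (Q + 1)`, the elements of order
dividing `Q - 1` are `(Q + 1)`-th powers. -/
lemma exists_pow_add_one_eq {G : Type*} [Group G] [Finite G] [IsCyclic G] {Q : ℕ} (hQ : 2 ≤ Q)
    (hdvd : (Q - 1) * (Q + 1) ∣ Nat.card G) {x : G} (hx : x ^ (Q - 1) = 1) :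
    ∃ z : G, z ^ (Q + 1) = x := by
  obtain ⟨θ, hθ⟩ := IsCyclic.exists_generator (α := G)
  obtain ⟨j, rfl⟩ := mem_powers_iff_mem_zpowers.2 (hθ x)
  obtain ⟨s, hs⟩ := hdvd
  have h1 : orderOf θ ∣ j * (Q - 1) := by
    rw [orderOf_dvd_iff_pow_eq_one, pow_mul]; exact hx
  rw [orderOf_eq_card_of_forall_mem_zpowers hθ, hs, mul_assoc, mul_comm j] at h1
  obtain ⟨t, ht⟩ := (Nat.dvd_of_mul_dvd_mul_left (by omega) h1)
  refine ⟨θ ^ (s * t), ?_⟩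
  change _ = θ ^ j
  rw [← pow_mul, ht]
  congr 1
  ring

/-- Nonzero elements fixed by `x ↦ x ^ Q` are norms from the quadratic extension, hence
`(Q + 1)`-th powers. -/
lemma exists_pow_add_one_eq_of_pow_eq_self {Q : ℕ} (hQ : 2 ≤ Q)
    (hdvd : (Q - 1) * (Q + 1) ∣ Nat.card F - 1) {x : F} (hx0 : x ≠ 0) (hx : x ^ Q = x) :
    ∃ z : F, z ≠ 0 ∧ z ^ (Q + 1) = x := by
  have hx1 : (Units.mk0 x hx0) ^ (Q - 1) = 1 := by
    ext
    simp only [Units.val_pow_eq_pow_val, Units.val_mk0, Units.val_one]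
    apply mul_right_cancel₀ hx0
    rw [one_mul, ← pow_succ, show Q - 1 + 1 = Q by omega, hx]
  obtain ⟨z, hz⟩ := exists_pow_add_one_eq hQ (by rwa [Nat.card_units]) hx1
  exact ⟨z, z.ne_zero, by simpa using congrArg Units.val hz⟩

/-- The units `η` with `η ^ m` fixed by `x ↦ x ^ Q` form `(Q - 1) / m₁` cosets of the group of
`m`-th roots of unity. -/
lemma exists_cosetReps {Q y m m₁ r : ℕ} (hQ : 2 ≤ Q) (hQF : Q - 1 ∣ Nat.card F - 1)
    (hm : m ∣ Nat.card F - 1) (hy : y = (Nat.card F - 1) / (Q - 1))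
    (hm₁ : m₁ = m / Nat.gcd m y) (hr : r ≤ (Q - 1) / m₁) :
    ∃ η : Fin r → Fˣ, Function.Injective (fun i => η i ^ m) ∧
      ∀ i, ((η i : F) ^ m) ^ Q = (η i : F) ^ m := by
  have hcard : 0 < Nat.card F - 1 := by
    have := Finite.one_lt_card (α := F)
    omega
  have hm0 : 0 < m := Nat.pos_of_dvd_of_pos hm hcard
  have hg0 : 0 < Nat.gcd m y := Nat.gcd_pos_of_pos_left _ hm0
  have hmg : m = m₁ * Nat.gcd m y := by rw [hm₁, Nat.div_mul_cancel (Nat.gcd_dvd_left _ _)]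
  have hyQ : (Q - 1) * y = Nat.card F - 1 := by rw [hy, Nat.mul_div_cancel' hQF]
  have hcop : Nat.Coprime m₁ (y / Nat.gcd m y) := by
    rw [hm₁]; exact Nat.coprime_div_gcd_div_gcd hg0
  have hyg : y = y / Nat.gcd m y * Nat.gcd m y :=
    (Nat.div_mul_cancel (Nat.gcd_dvd_right _ _)).symm
  have hm₁Q : m₁ ∣ Q - 1 := by
    refine hcop.dvd_of_dvd_mul_right (Nat.dvd_of_mul_dvd_mul_right hg0 ?_)
    rw [mul_assoc, ← hyg, hyQ, ← hmg]
    exact hm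
  obtain ⟨d, hd⟩ := hm₁Q
  have hm₁0 : 0 < m₁ := Nat.pos_of_ne_zero (by rintro rfl; simp at hmg; omega)
  have hrd : r ≤ d := by rwa [hd, Nat.mul_div_cancel_left _ hm₁0] at hr
  have hd0 : 0 < d := Nat.pos_of_ne_zero (by rintro rfl; omega)
  -- `η i = θ ^ (M * i)` for a generator `θ`, so that the `η i ^ m` lie in the
  -- subgroup of order `d`, and are distinct because `r ≤ d`
  have hdm : d * m ∣ Nat.card F - 1 := by
    refine ⟨y / Nat.gcd m y, ?_⟩
    rw [← hyQ, hd]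
    calc m₁ * d * y = m₁ * d * (y / Nat.gcd m y * Nat.gcd m y) := by rw [← hyg]
      _ = d * (m₁ * Nat.gcd m y) * (y / Nat.gcd m y) := by ring
      _ = d * m * (y / Nat.gcd m y) := by rw [← hmg]
  obtain ⟨M, hM⟩ := hdm
  obtain ⟨θ, hθ⟩ := IsCyclic.exists_generator (α := Fˣ)
  have hord : orderOf θ = d * m * M := by
    rw [orderOf_eq_card_of_forall_mem_zpowers hθ, Nat.card_units, hM]
  have hM0 : 0 < M := Nat.pos_of_ne_zero (by rintro rfl; omega)
  refine ⟨fun i => θ ^ (M * i), fun i j hij => ?_, fun i => ?_⟩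
  · simp only [← pow_mul] at hij
    have hlt : ∀ i : Fin r, M * i * m < orderOf θ := fun i => by
      rw [hord, show M * i * m = i * (m * M) by ring, mul_assoc]
      exact Nat.mul_lt_mul_of_pos_right (i.2.trans_le hrd) (by positivity)
    have := pow_injOn_Iio_orderOf (hlt i) (hlt j) hij
    exact Fin.ext (Nat.eq_of_mul_eq_mul_left hM0 (Nat.eq_of_mul_eq_mul_right hm0 this))
  · have h2 : ((θ ^ (M * (i : ℕ))) ^ m) ^ (Q - 1) = 1 := by
      rw [← pow_mul, ← pow_mul, ← orderOf_dvd_iff_pow_eq_one, hord, hd]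
      exact ⟨i * m₁, by ring⟩
    have h3 : ((θ ^ (M * (i : ℕ))) ^ m) ^ Q = (θ ^ (M * (i : ℕ))) ^ m := by
      conv_lhs => rw [show Q = Q - 1 + 1 by omega, pow_succ, h2, one_mul]
    exact_mod_cast congrArg Units.val h3

/-- If the coefficients of `g` and the element `x ^ m` are fixed by `σ`, then so is the derivative
of `X * g(X ^ m)` at `x`, as it is the value of `g + m X g'` at `x ^ m`. -/
lemma map_eval_derivative_eq {R : Type*} [CommRing R] (σ : R →+* R) {m : ℕ} (hm : 0 < m)
    {g : R[X]} (hg : g.map σ = g) {x : R} (hx : σ (x ^ m) = x ^ m) :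
    σ ((derivative (X * g.comp (X ^ m))).eval x) = (derivative (X * g.comp (X ^ m))).eval x := by
  have key : (derivative (X * g.comp (X ^ m))).eval x =
      (g + C (m : R) * X * derivative g).eval (x ^ m) := by
    obtain ⟨m, rfl⟩ : ∃ k, m = k + 1 := ⟨m - 1, by omega⟩
    simp [derivative_comp, eval_comp, derivative_X_pow_succ]
    ring
  have hh : (g + C (m : R) * X * derivative g).map σ = g + C (m : R) * X * derivative g := by
    simp [Polynomial.map_add, Polynomial.map_mul, ← derivative_map, hg]
  rw [key]
  conv_rhs => rw [← hh]
  rw [← hx, eval_map_apply, hx]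

/-- The union `S` of cosets on which the codes are built. Its union with `0` is the set of roots of
`X * ∏ i, (X ^ m - η i ^ m)`, and the Lagrange weights `w` there are fixed by `x ↦ x ^ p ^ l`. -/
lemma exists_evaluationSet {p l y m m₁ r : ℕ} [Fact p.Prime] [CharP F p] (hl : 1 ≤ l)
    (hQF : p ^ l - 1 ∣ Nat.card F - 1) (hm : m ∣ Nat.card F - 1)
    (hy : y = (Nat.card F - 1) / (p ^ l - 1)) (hm₁ : m₁ = m / Nat.gcd m y)
    (hr : r ≤ (p ^ l - 1) / m₁) :
    ∃ S : Finset F, IsUnionOfCosets m r (S : Set F) ∧ S.card = r * m ∧ 0 ∉ S ∧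
      ∃ w : F → F, (∀ x, x = 0 ∨ x ∈ S → w x ≠ 0 ∧ w x ^ p ^ l = w x) ∧
        ∀ P : F[X], P.degree < (r * m : ℕ) → w 0 * P.eval 0 + ∑ x ∈ S, w x * P.eval x = 0 := by
  classical
  have hQ : 2 ≤ p ^ l := (Fact.out : p.Prime).two_le.trans (Nat.le_self_pow (by omega) p)
  have hcard : 0 < Nat.card F - 1 := by
    have := Finite.one_lt_card (α := F)
    omega
  have hm0 : 0 < m := Nat.pos_of_dvd_of_pos hm hcard
  obtain ⟨η, hη, hηQ⟩ := exists_cosetReps (F := F) hQ hQF hm hy hm₁ hr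
  set H : Subgroup Fˣ := (powMonoidHom m : Fˣ →* Fˣ).ker with hH
  have hHm : ∀ t, t ∈ H ↔ t ^ m = 1 := fun t => Iff.rfl
  have hHcard : Nat.card H = m := by
    rw [hH, IsCyclic.card_powMonoidHom_ker, Nat.card_units, Nat.gcd_eq_right hm]
  have := Fintype.ofFinite H
  set e : Fin r × H → F := fun z => ((η z.1 * z.2.1 : Fˣ) : F) with he
  have hpow : ∀ z, e z ^ m = (η z.1 : F) ^ m := fun z => by
    have : ((z.2.1 : Fˣ) : F) ^ m = 1 := by
      rw [← Units.val_pow_eq_pow_val, (hHm _).1 z.2.2, Units.val_one]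
    simp [he, mul_pow, this]
  have hinj : Function.Injective e := by
    intro z z' hzz
    have h1 : z.1 = z'.1 := hη (by
      ext
      simpa [hpow] using congrArg (· ^ m) hzz)
    have h2 := Units.ext hzz
    rw [h1] at h2
    exact Prod.ext h1 (Subtype.ext (mul_left_cancel h2))
  set S : Finset F := Finset.univ.image e with hS
  have hScard : S.card = r * m := by
    rw [hS, Finset.card_image_of_injective _ hinj, Finset.card_univ, Fintype.card_prod,
      Fintype.card_fin, ← Nat.card_eq_fintype_card, hHcard]
  have hS0 : (0 : F) ∉ S := by
    intro h
    obtain ⟨z, -, hz⟩ := Finset.mem_image.1 h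
    exact Units.ne_zero _ hz
  have hSpow : ∀ x ∈ S, ∃ i, x ^ m = (η i : F) ^ m := by
    intro x hx
    obtain ⟨z, -, rfl⟩ := Finset.mem_image.1 hx
    exact ⟨z.1, hpow z⟩
  refine ⟨S, ⟨H, η, hHcard, fun i j hij hmem => hij (hη ?_), ?_⟩, hScard, hS0, ?_⟩
  · have h1 := (hHm _).1 hmem
    rw [mul_pow, inv_pow, inv_mul_eq_one] at h1
    exact h1
  · ext x
    simp only [hS, he, Finset.coe_image, Finset.coe_univ, Set.image_univ, Set.mem_range,
      Prod.exists, Subtype.exists, Set.mem_ofPred_eq]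
    exact ⟨fun ⟨i, t, ht, h⟩ => ⟨i, t, ht, h.symm⟩, fun ⟨i, t, ht, h⟩ => ⟨i, t, ht, h.symm⟩⟩
  set A : Finset F := insert 0 S with hA
  have hAcard : A.card = r * m + 1 := by rw [hA, Finset.card_insert_of_notMem hS0, hScard]
  set g : F[X] := ∏ i, (X - C ((η i : F) ^ m)) with hg
  have hgmonic : g.Monic := monic_prod_of_monic _ _ fun i _ => monic_X_sub_C _
  have hgdeg : g.natDegree = r := by
    rw [hg, natDegree_prod_of_monic _ _ fun i _ => monic_X_sub_C _]
    simp only [natDegree_X_sub_C, Finset.sum_const, Finset.card_univ, Fintype.card_fin, smul_eq_mul,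
      mul_one]
  have hgcomp : (g.comp (X ^ m)).Monic := hgmonic.comp (monic_X_pow m) (by simpa using hm0.ne')
  have hNmonic : (X * g.comp (X ^ m)).Monic := monic_X.mul hgcomp
  have hNdeg : (X * g.comp (X ^ m)).degree = (A.card : WithBot ℕ) := by
    rw [degree_eq_natDegree hNmonic.ne_zero, monic_X.natDegree_mul hgcomp, natDegree_comp, hgdeg,
      hAcard]
    simp [add_comm]
  have hnodal : X * g.comp (X ^ m) = Lagrange.nodal A id := by
    refine eq_of_degree_le_of_eval_finset_eq A hNdeg.le (by rw [hNdeg, Lagrange.degree_nodal])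
      (by rw [hNmonic, Lagrange.nodal_monic]) fun x hx => ?_
    have hx0 : (Lagrange.nodal A id).eval x = 0 :=
      Lagrange.eval_nodal_at_node (v := (id : F → F)) hx
    rw [hx0, eval_mul, eval_X]
    rcases Finset.mem_insert.1 hx with rfl | hx
    · simp
    · obtain ⟨i, hi⟩ := hSpow x hx
      rw [eval_comp, eval_pow, eval_X, hg, eval_prod,
        Finset.prod_eq_zero (Finset.mem_univ i) (by simp [hi]), mul_zero]
  set σ := iterateFrobenius F p l with hσ
  have hgσ : g.map σ = g := by
    simp only [hg, Polynomial.map_prod, Polynomial.map_sub, map_X, map_C]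
    refine Finset.prod_congr rfl fun i _ => ?_
    rw [iterateFrobenius_def, hηQ]
  have hinjA : Set.InjOn (id : F → F) A := Function.injective_id.injOn
  refine ⟨Lagrange.nodalWeight A id, fun x hx => ?_, fun P hP => ?_⟩
  · have hxA : x ∈ A := Finset.mem_insert.2 hx
    refine ⟨Lagrange.nodalWeight_ne_zero hinjA hxA, ?_⟩
    have hxσ : σ (x ^ m) = x ^ m := by
      rcases hx with rfl | hx
      · simp [zero_pow hm0.ne']
      · obtain ⟨i, hi⟩ := hSpow x hx
        rw [hi, iterateFrobenius_def, hηQ]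
    have h1 := map_eval_derivative_eq σ hm0 hgσ hxσ
    rw [Lagrange.nodalWeight_eq_eval_derivative_nodal hxA, ← hnodal, inv_pow]
    exact congrArg _ h1
  · have h1 := Lagrange.coeff_eq_sum hinjA (P := P)
      (hP.trans_le (by rw [hAcard]; exact_mod_cast Nat.le_succ _))
    rw [hAcard, Nat.add_sub_cancel, coeff_eq_zero_of_degree_lt hP] at h1
    rw [← Finset.sum_insert (f := fun x => Lagrange.nodalWeight A id x * P.eval x) hS0, ← hA, h1]
    refine Finset.sum_congr rfl fun x hx => ?_
    rw [Lagrange.nodalWeight, Finset.prod_inv_distrib, div_eq_mul_inv, mul_comm]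
    rfl

end NormAndCosets

/-! ### Multipliers -/

section HullDimension

variable {F : Type*} [Field F] [Finite F]

lemma degree_mul_pow_lt {R : Type*} [CommRing R] [IsDomain R] {k Q n : ℕ}
    (hkn : (k - 1) * (Q + 1) < n) {f g : R[X]}
    (hf : f ∈ degreeLT R k) (hg : g ∈ degreeLT R k) : (g * f ^ Q).degree < n := by
  have hnat : ∀ {h : R[X]}, h ∈ degreeLT R k → h.natDegree ≤ k - 1 := fun {h} hh => by
    rcases eq_or_ne h 0 with rfl | h0
    · simp
    · have := (natDegree_lt_iff_degree_lt h0).2 (mem_degreeLT.1 hh)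
      omega
  have h1 : (g * f ^ Q).natDegree ≤ (k - 1) + Q * (k - 1) :=
    natDegree_mul_le.trans (add_le_add (hnat hg)
      (natDegree_pow_le.trans (Nat.mul_le_mul_left _ (hnat hf))))
  refine degree_le_natDegree.trans_lt ?_
  have : (g * f ^ Q).natDegree < n := by
    have h2 : (k - 1) + Q * (k - 1) = (k - 1) * (Q + 1) := by ring
    omega
  exact_mod_cast this

/-- Column multipliers on the points of `A` whose Galois form has the given weights `w`, doubled
on a subset `T`. As `2` lies in the prime field, doubling keeps the weights `(p ^ l + 1)`-th
powers; each point of `T` then contributes one more term to the form. -/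
lemma exists_multipliers {p l : ℕ} [Fact p.Prime] [CharP F p] (hp : Odd p) (hl : 1 ≤ l)
    (hdvd : (p ^ l - 1) * (p ^ l + 1) ∣ Nat.card F - 1) (A : Finset F) {N : ℕ} (hN : A.card = N)
    (T : Finset F) (hT : T ⊆ A) (w : F → F) (hw : ∀ x ∈ A, w x ≠ 0 ∧ w x ^ p ^ l = w x) :
    ∃ a v : Fin N → F, Function.Injective a ∧ Set.range a = A ∧ (∀ i, v i ≠ 0) ∧
      ∀ f g : F[X], galoisForm p l (fun i => v i * g.eval (a i)) (fun i => v i * f.eval (a i)) =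
        ∑ x ∈ A, w x * (g * f ^ p ^ l).eval x + ∑ x ∈ T, w x * (g * f ^ p ^ l).eval x := by
  classical
  have hQ : 2 ≤ p ^ l := (Fact.out : p.Prime).two_le.trans (Nat.le_self_pow (by omega) p)
  have h2 : (2 : F) ≠ 0 := by
    intro h
    have h3 : ((2 : ℕ) : F) = 0 := by exact_mod_cast h
    rw [CharP.cast_eq_zero_iff F p, Nat.prime_dvd_prime_iff_eq Fact.out Nat.prime_two] at h3
    subst h3
    exact absurd hp (by decide)
  set w' : F → F := fun x => if x ∈ T then 2 * w x else w x with hw'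
  have hfix : ∀ x ∈ A, w' x ≠ 0 ∧ w' x ^ p ^ l = w' x := by
    intro x hx
    obtain ⟨h3, h4⟩ := hw x hx
    by_cases hxT : x ∈ T
    · simp only [hw', hxT, if_true]
      refine ⟨mul_ne_zero h2 h3, ?_⟩
      rw [mul_pow, h4, ← iterateFrobenius_def (R := F) (p := p) (n := l) (x := (2 : F)), map_ofNat]
    · simpa only [hw', hxT, if_false] using And.intro h3 h4
  let a : Fin N → F := fun i => ((A.equivFinOfCardEq hN).symm i).1
  have haA : ∀ i, a i ∈ A := fun i => ((A.equivFinOfCardEq hN).symm i).2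
  choose v hv0 hv using fun i => exists_pow_add_one_eq_of_pow_eq_self hQ hdvd
    (hfix (a i) (haA i)).1 (hfix (a i) (haA i)).2
  have ha : Function.Injective a :=
    Subtype.val_injective.comp (A.equivFinOfCardEq hN).symm.injective
  have himg : Finset.univ.image a = A := by
    refine Finset.eq_of_subset_of_card_le (fun x hx => ?_) ?_
    · obtain ⟨i, -, rfl⟩ := Finset.mem_image.1 hx
      exact haA i
    · rw [Finset.card_image_of_injective _ ha, Finset.card_fin, hN]
  refine ⟨a, v, ha, by rw [← himg]; simp, hv0, fun f g => ?_⟩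
  set P := g * f ^ p ^ l with hP
  have h5 : ∑ x ∈ A, w' x * P.eval x =
      ∑ x ∈ A, w x * P.eval x + ∑ x ∈ T, w x * P.eval x := by
    conv_rhs => rw [← Finset.inter_eq_right.2 hT, ← Finset.sum_ite_mem, ← Finset.sum_add_distrib]
    refine Finset.sum_congr rfl fun x _ => ?_
    by_cases hxT : x ∈ T
    · simp only [hw', hxT, if_true]
      ring
    · simp [hw', hxT]
  rw [← h5, ← himg, Finset.sum_image ha.injOn, galoisForm]
  refine Finset.sum_congr rfl fun i _ => ?_
  rw [← hv i, hP, eval_mul, eval_pow]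
  ring

end HullDimension

/-! ### Assembly of the three families of codes -/

theorem theorem4 (p e l q y m m₁ r n : ℕ) [Fact p.Prime] (hp : Odd p) (he : 1 ≤ e)
    (hq : q = p ^ e) (F : Type*) [Field F] [Finite F] [CharP F p] (hF : Nat.card F = q)
    (hle : 2 * l ∣ e) (hm : m ∣ q - 1)
    (hy : y = (q - 1) / (p ^ l - 1)) (hm₁ : m₁ = m / Nat.gcd m y)
    (hr₁ : 1 ≤ r) (hr : r ≤ (p ^ l - 1) / m₁) (hn : n = r * m) :
    ∃ S : Set F, IsUnionOfCosets m r S ∧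
      ∀ k : ℕ, 1 ≤ k → k ≤ (p ^ l + n) / (p ^ l + 1) →
        (∀ h : ℕ, h ≤ k - 1 → ∃ C : Submodule F (Fin n → F),
          IsMDSCode k C ∧ Module.finrank F (galoisHull p l C) = h ∧
          IsGRSOn k S C) ∧
        (∀ h : ℕ, h ≤ k → ∃ C : Submodule F (Fin (n + 1) → F),
          IsMDSCode k C ∧ Module.finrank F (galoisHull p l C) = h ∧
          IsGRSOn k (insert 0 S) C) ∧
        (∀ h : ℕ, h ≤ k - 1 → ∃ C : Submodule F (Fin (n + 2) → F),
          IsMDSCode k C ∧ Module.finrank F (galoisHull p l C) = h ∧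
          IsExtGRSOn k (insert 0 S) C) := by
  classical
  have hl : 1 ≤ l := by
    rcases Nat.eq_zero_or_pos l with rfl | h
    · rw [mul_zero, zero_dvd_iff] at hle
      omega
    · exact h
  subst hF
  have hdvd : (p ^ l - 1) * (p ^ l + 1) ∣ Nat.card F - 1 := by
    obtain ⟨s, rfl⟩ := hle
    have h1 := Nat.sub_dvd_pow_sub_pow (p ^ (2 * l)) 1 s
    rw [one_pow, ← pow_mul, ← hq] at h1
    have h2 := Nat.sq_sub_sq (p ^ l) 1
    rw [one_pow, ← pow_mul, mul_comm l 2] at h2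
    rwa [h2, mul_comm] at h1
  obtain ⟨S, hS, hScard, hS0, w, hw, hsum⟩ := exists_evaluationSet (F := F) (p := p) hl
    ((Dvd.intro _ rfl).trans hdvd) hm hy hm₁ hr
  rw [← hn] at hScard hsum
  have hwS : ∀ x ∈ S, w x ≠ 0 ∧ w x ^ p ^ l = w x := fun x hx => hw x (Or.inr hx)
  have hwA : ∀ x ∈ insert 0 S, w x ≠ 0 ∧ w x ^ p ^ l = w x := fun x hx =>
    hw x (Finset.mem_insert.1 hx)
  have hAcard : (insert 0 S : Finset F).card = n + 1 := by
    rw [Finset.card_insert_of_notMem hS0, hScard]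
  refine ⟨S, hS, fun k hk1 hk => ?_⟩
  have hdeg : (k - 1) * (p ^ l + 1) < n := by
    have h1 := (Nat.le_div_iff_mul_le (by omega)).1 hk
    obtain ⟨k, rfl⟩ : ∃ j, k = j + 1 := ⟨k - 1, by omega⟩
    rw [Nat.add_sub_cancel]
    rw [add_mul] at h1
    omega
  have hkn : k ≤ n := by
    have : k - 1 ≤ (k - 1) * (p ^ l + 1) := Nat.le_mul_of_pos_right _ (by omega)
    omega
  have hkF : k ≤ Nat.card F := by
    have := Fintype.ofFinite F
    rw [Nat.card_eq_fintype_card]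
    exact (hkn.trans hScard.ge).trans (Finset.card_le_univ S)
  have hvanish : ∀ f ∈ degreeLT F k, ∀ g ∈ degreeLT F k,
      w 0 * (g * f ^ p ^ l).eval 0 + ∑ x ∈ S, w x * (g * f ^ p ^ l).eval x = 0 :=
    fun f hf g hg => hsum _ (degree_mul_pow_lt hdeg hf hg)
  have hsub : ∀ t ≤ k, ∃ T ⊆ S, T.card = t := fun t ht =>
    Finset.exists_subset_card_eq (by omega)
  refine ⟨fun h hh => ?_, fun h hh => ?_, fun h hh => ?_⟩
  -- the missing point `0` contributes the term `-w 0 * g(0) * f(0) ^ p ^ l`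
  · obtain ⟨T, hTS, hT⟩ := hsub (k - 1 - h) (by omega)
    have hT0 : (0 : F) ∉ T := fun h => hS0 (hTS h)
    obtain ⟨a, v, ha, haS, hv, hform⟩ := exists_multipliers hp hl hdvd S hScard T hTS w hwS
    have hpt : Function.Injective fun i => some (a i) := (Option.some_injective F).comp ha
    refine ⟨grsCode k a v, ?_, ?_, a, v, ha, haS, hv, rfl⟩
    · exact isMDSCode_projCode hpt hv hk1 hkn
    have hJ : ((insert 0 T).map Function.Embedding.some).card = k - h := by
      rw [Finset.card_map, Finset.card_insert_of_notMem hT0, hT]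
      omega
    have := finrank_galoisHull_projCode (p := p) (l := l) hpt hv hkn hkF
      ((insert 0 T).map Function.Embedding.some) (by omega)
      (fun x => x.elim 0 fun x => if x = 0 then -w x else w x) (by
        intro j hj
        obtain ⟨x, hx, rfl⟩ := Finset.mem_map.1 hj
        rcases Finset.mem_insert.1 hx with rfl | hx
        · simpa using (hw 0 (Or.inl rfl)).1
        · have hx0 : x ≠ 0 := fun h => hT0 (h ▸ hx)
          simpa [hx0] using (hwS x (hTS hx)).1) (by
        intro f hf g hg
        refine (hform f g).trans ?_
        rw [Finset.sum_map, Finset.sum_insert hT0, eq_neg_of_add_eq_zero_right (hvanish f hf g hg)]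
        congr 1
        · simp
        · refine Finset.sum_congr rfl fun x hx => ?_
          have hx0 : x ≠ 0 := fun h => hT0 (h ▸ hx)
          simp [hx0])
    rw [grsCode_eq_projCode, this]
    omega
  · obtain ⟨T, hTS, hT⟩ := hsub (k - h) (by omega)
    obtain ⟨a, v, ha, haS, hv, hform⟩ := exists_multipliers hp hl hdvd (insert 0 S) hAcard T
      (hTS.trans (Finset.subset_insert _ _)) w hwA
    have hpt : Function.Injective fun i => some (a i) := (Option.some_injective F).comp ha
    refine ⟨grsCode k a v, ?_, ?_, a, v, ha, by rw [haS, Finset.coe_insert], hv, rfl⟩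
    · exact isMDSCode_projCode hpt hv hk1 (by omega)
    have := finrank_galoisHull_projCode (p := p) (l := l) hpt hv (by omega) hkF
      (T.map Function.Embedding.some) (by rw [Finset.card_map]; omega)
      (fun x => x.elim 0 w) (by
        intro j hj
        obtain ⟨x, hx, rfl⟩ := Finset.mem_map.1 hj
        exact (hwS x (hTS hx)).1) (by
        intro f hf g hg
        refine (hform f g).trans ?_
        rw [Finset.sum_map, Finset.sum_insert hS0, hvanish f hf g hg, zero_add]
        simp)
    rw [grsCode_eq_projCode, this, Finset.card_map]
    omega
  -- the point at infinity contributes a term of its own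
  · obtain ⟨T, hTS, hT⟩ := hsub (k - 1 - h) (by omega)
    obtain ⟨a, v, ha, haS, hv, hform⟩ := exists_multipliers hp hl hdvd (insert 0 S) hAcard T
      (hTS.trans (Finset.subset_insert _ _)) w hwA
    set pt : Fin (n + 2) → Option F :=
      Fin.snoc (α := fun _ => Option F) (fun i => some (a i)) none with hptdef
    set v' : Fin (n + 2) → F := Fin.snoc (α := fun _ => F) v 1 with hv'def
    have hpt : Function.Injective pt := by
      rw [hptdef, Fin.snoc_injective_iff]
      exact ⟨(Option.some_injective F).comp ha, by simp⟩
    have hv' : ∀ i, v' i ≠ 0 := by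
      intro i
      refine Fin.lastCases ?_ (fun j => ?_) i
      · simp [hv'def]
      · simpa [hv'def] using hv j
    refine ⟨extGrsCode k a v, ?_, ?_, a, v, ha, by rw [haS, Finset.coe_insert], hv, rfl⟩
    · rw [extGrsCode_eq_projCode]
      exact isMDSCode_projCode hpt hv' hk1 (by omega)
    have := finrank_galoisHull_projCode (p := p) (l := l) hpt hv' (by omega) hkF
      (Finset.insertNone T) (by rw [Finset.card_insertNone]; omega)
      (fun x => x.elim 1 w) (by
        intro j hj
        cases j with
        | none => simp
        | some x => exact (hwS x (hTS (Finset.some_mem_insertNone.1 hj))).1) (by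
        intro f hf g hg
        have h1 := hform f g
        rw [Finset.sum_insert hS0, hvanish f hf g hg, zero_add, galoisForm] at h1
        rw [galoisForm, Fin.sum_univ_castSucc, Finset.sum_insertNone, add_comm]
        congr 1
        · simp [hptdef, hv'def]
        · simpa [hptdef, hv'def] using h1)
    rw [extGrsCode_eq_projCode, this, Finset.card_insertNone]
    omega
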